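/- **Setting.** A network $\mathcal N=(\mathcal V,\mathcal E,C)$ is a finite directed multigraph with link capacities $C_e>0$, a unique node $0$ without incoming links (the origin) and a unique node $n\neq 0$ without outgoing links (the destination), every other node lying on a directed path from $0$ to $n$. Write $\sigma_e,\tau_e$ for the tail and head of a link $e$, and $\mathcal E_v^+,\mathcal E_v^-$ for the sets of outgoing and incoming links of $v$. A constant inflow $\lambda>0$ enters at the origin; put $\lambda_0:=\lambda$ and $\lambda_v:=0$ for $v\ne 0$. *Routing.* A distributed routing policy is a family of functions $G^v(\mathcal J,\cdot):\mathbb R_+\to\mathbb R_+^{\mathcal J}$, $v\ne n$, $\emptyset\ne\mathcal J\subseteq\mathcal E_v^+$, with $\sum_{e\in\mathcal J}G^v_e(\mathcal J,\mu)=\mu$ and $G^v_e(\mathcal J,\mu)\le G^v_e(\mathcal K,\mu)$ for all $\mu\ge0$, $\emptyset\neq\mathcal K\subseteq\mathcal J$, $e\in\mathcal K$; put $G^v_e(\mathcal J,\mu):=0$ for $e\notin\mathcal J$. It is flow-monotone if for all $v\notin\{0,n\}$, all $\mathcal J$ and all $0\le\mu_1\le\mu_2$ one has $G^v_e(\mathcal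 J,\mu_1)\le G^v_e(\mathcal J,\mu_2)$ for $e\in\mathcal J$. *Dynamics.* The state at time $t=0,1,\dots$ consists of active non-destination nodes $\mathcal V(t)$, active links $\mathcal E(t)$, flows $f(t)$ and residual capacities $C(t)$. Initially $\mathcal V(0)=\mathcal V\setminus\{n\}$, $\mathcal E(0)=\mathcal E$, $C(0)=C$, and $f(0)\ge0$ is the flow prescribed by the policy: $f_e(0)=G^v_e(\mathcal E_v^+,\lambda_v+\sum_{j\in\mathcal E_v^-}f_j(0))$ for $e\in\mathcal E_v^+$, $v\ne n$. With $\mathcal E_v^\pm(t):=\mathcal E_v^\pm\cap\mathcal E(t)$ and $\lambda_v(t):=\lambda_v+\sum_{e\in\mathcal E_v^-(t)}f_e(t)$, $$\mathcal E(t+1)=\{e\in\mathcal E(t): f_e(t)<C_e(t)\text{ and }\tau_e\in\mathcal V(t)\cup\{n\}\},\qquad \mathcal V(t+1)=\{v\in\mathcal V(t):\mathcal E_v^+(t)\neq\emptyset\},$$ $$f_e(t+1)=G^v_e(\mathcal E_v^+(t),\lambda_v(t))\ \text{ for } v\in\mathcal V(t),\ e\in\mathcal E_v^+(t),\qquad f_e(t+1)=0\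 \text{ for all other links},$$ and $C(t+1)=C(t)-\delta(t+1)$. A disturbance process is a sequence $\delta(1),\delta(2),\dots\in\mathbb R_+^{\mathcal E}$ with $\sum_{s\le t}\delta(s)\le C$ for all $t$; its magnitude is $\mathcal D(\delta):=\sum_{e}\sum_{t\ge1}\delta_e(t)$. The dynamics is transferring if $\lim_{t\to\infty}\sum_{e\in\mathcal E_n^-}f_e(t)=\lambda$. *Backward Propagation Algorithm (BPA).* Suppose that the network has no directed cycle. For $v\ne n$, $\mathcal J\subseteq\mathcal E_v^+$, $r\in\mathbb R_+^{\mathcal E_v^+}$ and $\mu\ge0$ let $\mathcal X_v(\mathcal J,r,\mu)$ be the set of $x\in\mathbb R_+^{\mathcal J}$ with $r_e\le x_e\le C_e$ for $e\in\mathcal J$ and $\sum_{e\in\mathcal J}x_e=\mu$. Going backward from the destination, define $S(\mathcal J,r,\mu):=0$ if $\mathcal J=\emptyset$ or $\mathcal X_v(\mathcal J,r,\mu)=\emptyset$, and otherwise $$S(\mathcal J,r,\mu):=\max_{x\in\mathcal X_v(\mathcal J,r,\mu)}\ \min_{e\in\mathcal J}\Big(S_e(x_e)+S(\mathcal J\setminus\{e\},x,\mu)\Big),$$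 where $S_e(x):=C_e-x$ if $\tau_e=n$ and $S_e(x):=\min\{C_e-x,\,S(\mathcal E_{\tau_e}^+,\mathbf 0,x)\}$ otherwise. Let $g(\mathcal J,r,\mu)$ be the set of maximizers, and $S^*(\mathcal N,\lambda):=S(\mathcal E_0^+,\mathbf 0,\lambda)$. BPA routing is a distributed routing policy such that, for every $v\neq n$ and $\mu\ge0$, with $r^*:=G^v(\mathcal E_v^+,\mu)$: $r^*\in g(\mathcal E_v^+,\mathbf 0,\mu)$ if $\mathcal X_v(\mathcal E_v^+,\mathbf 0,\mu)\ne\emptyset$, and $G^v(\mathcal J,\mu)\in g(\mathcal J,r^*,\mu)$ for every nonempty $\mathcal J\subsetneq\mathcal E_v^+$ with $\mathcal X_v(\mathcal J,r^*,\mu)\neq\emptyset$. **Theorem.** Let $\mathcal N$ be a network with $|\mathcal E_v^+|\le3$ for all $v\neq n$, such that $(\mathcal V\setminus\{n\},\mathcal E\setminus\mathcal E_n^-)$ is a directed tree (the underlying undirected multigraph is a tree). Let $\lambda>0$ be the constant inflow at the origin, and let the routing policy be a BPA routing that is flow-monotone. Then the dynamics is transferring under every disturbance process $\delta$ with $\mathcal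 D(\delta)<S^*(\mathcal N,\lambda)$. -/

import Mathlib

open Filter Topology

noncomputable section

namespace CascadingFailure

/-- A single-commodity flow network: a finite directed multigraph with node set `V` and link set
`E` (parallel links are allowed), strictly positive link capacities, a unique node `origin` without
incoming links and a unique node `dest` without outgoing links.  Every other node lies on a
directed path from `origin` to `dest`. -/
structure Network (V E : Type*) where
  tail : E → V
  head : E → V
  cap : E → ℝ
  cap_pos : ∀ e, 0 < cap e
  origin : V
  dest : V
  origin_ne_dest : origin ≠ dest
  origin_iff : ∀ v, (∀ e, head e ≠ v) ↔ v = origin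
  dest_iff : ∀ v, (∀ e, tail e ≠ v) ↔ v = dest
  on_path : ∀ v, v ≠ origin → v ≠ dest →
    Relation.ReflTransGen (fun u w => ∃ e, tail e = u ∧ head e = w) origin v ∧
    Relation.ReflTransGen (fun u w => ∃ e, tail e = u ∧ head e = w) v dest

namespace Network

variable {V E : Type*} (N : Network V E)

/-- There is a link from `u` to `w`. -/
def Step (u w : V) : Prop := ∃ e, N.tail e = u ∧ N.head e = w

/-- The network contains no directed cycle. -/
def Acyclic : Prop := ∀ v, ¬ Relation.TransGen N.Step v v

/-- The simple undirected graph underlying the network without the destination node (and hence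
without the links into it). -/
def coreGraph : SimpleGraph {v : V // v ≠ N.dest} :=
  SimpleGraph.fromRel (fun u w => N.Step u w)

/-- The network without its destination node and without the links into the destination is a
directed tree: the undirected multigraph underlying it has no loops, no two links between the
same pair of nodes, and is a tree. -/
structure IsTree : Prop where
  no_loop : ∀ e, N.head e ≠ N.dest → N.tail e ≠ N.head e
  no_parallel : ∀ e e', N.head e ≠ N.dest → N.head e' ≠ N.dest →
    s(N.tail e, N.head e) = s(N.tail e', N.head e') → e = e'
  isTree : N.coreGraph.IsTree

variable {N}

theorem tail_ne_dest (e : E) : N.tail e ≠ N.dest :=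
  (N.dest_iff N.dest).2 rfl e

theorem Acyclic.wf [Finite V] (h : N.Acyclic) : WellFounded (fun w v => N.Step v w) := by
  have : IsTrans V (fun w v => Relation.TransGen N.Step v w) :=
    ⟨fun _ _ _ hab hbc => hbc.trans hab⟩
  have : Std.Irrefl (fun w v => Relation.TransGen N.Step v w) := ⟨h⟩
  exact Subrelation.wf (fun hs => Relation.TransGen.single hs)
    (Finite.wellFounded_of_trans_of_irrefl (fun w v => Relation.TransGen N.Step v w))

/-- A directed tree has no directed cycle. -/
theorem IsTree.acyclic (h : N.IsTree) : N.Acyclic := by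
  intro v hv
  obtain ⟨w, ⟨e, rfl, rfl⟩, hw⟩ := Relation.TransGen.head'_iff.1 hv
  have hd : N.head e ≠ N.dest := by
    intro hd
    rw [hd] at hw
    rcases Relation.ReflTransGen.cases_head hw with h1 | ⟨c, ⟨e', h1, -⟩, -⟩
    · exact tail_ne_dest e h1.symm
    · exact tail_ne_dest e' h1
  have hadj : N.coreGraph.Adj ⟨N.tail e, tail_ne_dest e⟩ ⟨N.head e, hd⟩ := by
    rw [coreGraph, SimpleGraph.fromRel_adj]
    exact ⟨fun hh => h.no_loop e hd (congrArg Subtype.val hh), Or.inl ⟨e, rfl, rfl⟩⟩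
  have hb := SimpleGraph.isAcyclic_iff_forall_adj_isBridge.1 h.isTree.isAcyclic hadj
  rw [SimpleGraph.isBridge_iff] at hb
  have key : ∀ u, Relation.ReflTransGen N.Step u (N.tail e) → ∀ hu : u ≠ N.dest,
      (N.coreGraph.deleteEdges {s(⟨N.tail e, tail_ne_dest e⟩, ⟨N.head e, hd⟩)}).Reachable
        ⟨u, hu⟩ ⟨N.tail e, tail_ne_dest e⟩ := by
    intro u hu
    induction hu using Relation.ReflTransGen.head_induction_on with
    | refl => intro _; exact SimpleGraph.Reachable.refl _
    | head h1 h2 ih =>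
      rename_i a c
      intro ha
      obtain ⟨e', rfl, rfl⟩ := h1
      have hc : N.head e' ≠ N.dest := by
        intro hc
        rw [hc] at h2
        rcases Relation.ReflTransGen.cases_head h2 with h3 | ⟨_, ⟨e'', h3, -⟩, -⟩
        · exact tail_ne_dest e h3.symm
        · exact tail_ne_dest e'' h3
      by_cases hee : e' = e
      · subst hee; exact SimpleGraph.Reachable.refl _
      · refine SimpleGraph.Reachable.trans (SimpleGraph.Adj.reachable ?_) (ih hc)
        rw [SimpleGraph.deleteEdges_adj]
        refine ⟨?_, ?_⟩
        · rw [coreGraph, SimpleGraph.fromRel_adj]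
          exact ⟨fun hh => h.no_loop e' hc (congrArg Subtype.val hh), Or.inl ⟨e', rfl, rfl⟩⟩
        · intro hs
          have hs' := congrArg (Sym2.map Subtype.val) (Set.mem_singleton_iff.1 hs)
          simp only [Sym2.map_mk] at hs'
          exact hee (h.no_parallel e' e hc hd hs')
  exact hb (key _ hw hd).symm

variable (N) [Fintype V] [Fintype E] [DecidableEq V] [DecidableEq E]

/-- The links going out of `v`. -/
def outLinks (v : V) : Finset E := Finset.univ.filter (fun e => N.tail e = v)

/-- The links coming into `v`. -/
def inLinks (v : V) : Finset E := Finset.univ.filter (fun e => N.head e = v)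

/-- The external inflow: `lam` at the origin and zero at every other node. -/
def extInflow (lam : ℝ) (v : V) : ℝ := if v = N.origin then lam else 0

/-! ### Routing policies -/

/-- A distributed oblivious routing policy.  `split v J μ e` is the flow that node `v` sends on
link `e` when its active outgoing links are `J` and its inflow is `μ`. -/
structure RoutingPolicy where
  split : V → Finset E → ℝ → E → ℝ
  nonneg : ∀ v, v ≠ N.dest → ∀ J ⊆ N.outLinks v, J.Nonempty → ∀ μ, 0 ≤ μ → ∀ e,
    0 ≤ split v J μ e
  support : ∀ v, v ≠ N.dest → ∀ J ⊆ N.outLinks v, J.Nonempty → ∀ μ, 0 ≤ μ → ∀ e, e ∉ J →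
    split v J μ e = 0
  sum_eq : ∀ v, v ≠ N.dest → ∀ J ⊆ N.outLinks v, J.Nonempty → ∀ μ, 0 ≤ μ →
    ∑ e ∈ J, split v J μ e = μ
  /-- link monotonicity -/
  link_mono : ∀ v, v ≠ N.dest → ∀ J ⊆ N.outLinks v, ∀ K ⊆ J, K.Nonempty → ∀ μ, 0 ≤ μ →
    ∀ e ∈ K, split v J μ e ≤ split v K μ e

variable {N} in
/-- The policy is flow-monotone at `v`. -/
def RoutingPolicy.FlowMonotoneAt (G : N.RoutingPolicy) (v : V) : Prop :=
  ∀ J ⊆ N.outLinks v, J.Nonempty → ∀ μ₁ μ₂, 0 ≤ μ₁ → μ₁ ≤ μ₂ →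
    ∀ e ∈ J, G.split v J μ₁ e ≤ G.split v J μ₂ e

variable {N} in
/-- The policy is flow-monotone over the network, i.e. at every node other than the origin and
the destination. -/
def RoutingPolicy.FlowMonotone (G : N.RoutingPolicy) : Prop :=
  ∀ v, v ≠ N.origin → v ≠ N.dest → G.FlowMonotoneAt v

/-! ### The Backward Propagation Algorithm -/

/-- The nonnegative vectors on `J` (extended by zero outside `J`) that lie between `r` and the
capacities on `J` and have total `μ`. -/
def feasible (J : Finset E) (r : E → ℝ) (μ : ℝ) : Set (E → ℝ) :=
  {x | (∀ e ∈ J, 0 ≤ x e ∧ r e ≤ x e ∧ x e ≤ N.cap e) ∧ (∀ e, e ∉ J → x e = 0) ∧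
    ∑ e ∈ J, x e = μ}

open Classical in
/-- The recursion over sets of links going out of one node, for given functions
`link e` on the individual links: the value is `0` if `J` is empty or no vector is feasible, and
otherwise the maximum over the feasible `x` of
`min_{e ∈ J} (link e (x e) + setMargin (J \ {e}) x μ)`. -/
def setMargin (link : E → ℝ → ℝ) (J : Finset E) (r : E → ℝ) (μ : ℝ) : ℝ :=
  if hJ : J.Nonempty then
    if (N.feasible J r μ).Nonempty then
      sSup ((fun x => J.attach.inf' hJ.attach
        (fun e => link e.1 (x e.1) + setMargin link (J.erase e.1) x μ)) '' N.feasible J r μ)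
    else 0
  else 0
termination_by J.card
decreasing_by exact Finset.card_erase_lt_of_mem e.2

variable {N} in
/-- `nodeMargin v μ` is the value that the algorithm computes at the node `v ≠ dest` for the set of
all links going out of `v`, zero lower bound and inflow `μ`; it is computed from the values at the
heads of these links.  The destination has value `+∞`, so that for a link `e` into the destination
`min {C_e - x, +∞} = C_e - x`. -/
def nodeMargin (h : N.Acyclic) : V → ℝ → ℝ :=
  h.wf.fix (fun v ih μ => N.setMargin
    (fun e x => if he : N.tail e = v ∧ N.head e ≠ N.dest then
        min (N.cap e - x) (ih (N.head e) ⟨e, he.1, rfl⟩ x)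
      else N.cap e - x)
    (N.outLinks v) 0 μ)

variable {N} in
/-- `S_e(μ) = min {C_e - μ, S(E⁺_{head e}, 0, μ)}`, where the second term is `+∞` if `e` leads into
the destination. -/
def linkMargin (h : N.Acyclic) (e : E) (μ : ℝ) : ℝ :=
  if N.head e = N.dest then N.cap e - μ else min (N.cap e - μ) (nodeMargin h (N.head e) μ)

variable {N} in
/-- `S(J, r, μ)`. -/
def margin (h : N.Acyclic) (J : Finset E) (r : E → ℝ) (μ : ℝ) : ℝ :=
  N.setMargin (linkMargin h) J r μ

variable {N} in
/-- `S*(N, lam) = S(E⁺_origin, 0, lam)`. -/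
def upperMargin (h : N.Acyclic) (lam : ℝ) : ℝ := margin h (N.outLinks N.origin) 0 lam

variable {N} in
/-- The recursive step at a set of links, as the algorithm states it. -/
theorem margin_eq (h : N.Acyclic) {J : Finset E} (hJ : J.Nonempty) {r : E → ℝ} {μ : ℝ}
    (hX : (N.feasible J r μ).Nonempty) :
    margin h J r μ = sSup ((fun x => J.attach.inf' hJ.attach
      (fun e => linkMargin h e.1 (x e.1) + margin h (J.erase e.1) x μ)) '' N.feasible J r μ) := by
  rw [margin, setMargin, dif_pos hJ, if_pos hX]
  rfl

set_option linter.unusedSectionVars false in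
theorem setMargin_congr {l₁ l₂ : E → ℝ → ℝ} (J : Finset E) (hl : ∀ e ∈ J, l₁ e = l₂ e)
    (r : E → ℝ) (μ : ℝ) : N.setMargin l₁ J r μ = N.setMargin l₂ J r μ := by
  induction hn : J.card using Nat.strong_induction_on generalizing J r with
  | _ n ih =>
    subst hn
    rw [setMargin, setMargin]
    split_ifs with hJ hX
    · congr 2
      funext x
      congr 1
      funext e
      rw [hl e.1 e.2, ih _ (Finset.card_erase_lt_of_mem e.2) _
        (fun e' he' => hl e' (Finset.mem_of_mem_erase he')) x rfl]
    · rfl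
    · rfl

variable {N} in
/-- The value at a node is `S(E⁺_v, 0, μ)`. -/
theorem nodeMargin_eq (h : N.Acyclic) (v : V) (μ : ℝ) :
    nodeMargin h v μ = margin h (N.outLinks v) 0 μ := by
  rw [nodeMargin, WellFounded.fix_eq, margin]
  refine N.setMargin_congr _ (fun e he => ?_) _ _
  have ht : N.tail e = v := by simpa [outLinks] using he
  funext x
  by_cases hd : N.head e = N.dest
  · simp [linkMargin, hd]
  · simp [linkMargin, hd, ht, nodeMargin]

variable {N} in
/-- The maximizers in the recursive step at `J`. -/
def maximizers (h : N.Acyclic) (J : Finset E) (r : E → ℝ) (μ : ℝ) : Set (E → ℝ) :=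
  {x | x ∈ N.feasible J r μ ∧ ∃ hJ : J.Nonempty, IsMaxOn (fun y => J.attach.inf' hJ.attach
    (fun e => linkMargin h e.1 (y e.1) + margin h (J.erase e.1) y μ)) (N.feasible J r μ) x}

variable {N} in
/-- The policy is a BPA routing: with all links of a node active it uses a maximizer for the lower
bound `0`, and with a proper subset of them active a maximizer for the lower bound `r*` given by its
own action with all links active and the same inflow.  If no vector is feasible (the inflow is too
large for the capacities), then there is no maximizer, and the action is only restricted by the
definition of a routing policy. -/
def RoutingPolicy.IsBPA (h : N.Acyclic) (G : N.RoutingPolicy) : Prop :=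
  ∀ v, v ≠ N.dest → ∀ μ, 0 ≤ μ →
    ((N.feasible (N.outLinks v) 0 μ).Nonempty →
      G.split v (N.outLinks v) μ ∈ maximizers h (N.outLinks v) 0 μ) ∧
    ∀ J ⊂ N.outLinks v, J.Nonempty →
      (N.feasible J (G.split v (N.outLinks v) μ) μ).Nonempty →
      G.split v J μ ∈ maximizers h J (G.split v (N.outLinks v) μ) μ

/-! ### The network flow dynamics -/

/-- The state of the network: active non-destination nodes, active links, link flows and residual
link capacities. -/
structure State (V E : Type*) where
  nodes : Finset V
  links : Finset E
  flow : E → ℝ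
  resCap : E → ℝ

/-- The active links going out of `v`. -/
def activeOut (s : State V E) (v : V) : Finset E := N.outLinks v ∩ s.links

/-- The current inflow at `v`, external and from active links. -/
def currentInflow (lam : ℝ) (s : State V E) (v : V) : ℝ :=
  N.extInflow lam v + ∑ e ∈ N.inLinks v ∩ s.links, s.flow e

/-- `f` is the initial flow specified by the policy: every non-destination node splits its inflow
among all its outgoing links as the policy prescribes.  (In particular `f` conserves mass at every
non-destination node.) -/
structure IsInitialFlow (G : N.RoutingPolicy) (lam : ℝ) (f : E → ℝ) : Prop where
  nonneg : ∀ e, 0 ≤ f e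
  routed : ∀ v, v ≠ N.dest → ∀ e ∈ N.outLinks v,
    f e = G.split v (N.outLinks v) (N.extInflow lam v + ∑ e' ∈ N.inLinks v, f e') e

/-- The initial state: all non-destination nodes and all links are active. -/
def initState (f₀ : E → ℝ) : State V E where
  nodes := Finset.univ.erase N.dest
  links := Finset.univ
  flow := f₀
  resCap := N.cap

/-- One step of the dynamics, with capacity reduction `d`.  The destination never becomes
inactive. -/
def nextState (G : N.RoutingPolicy) (lam : ℝ) (s : State V E) (d : E → ℝ) : State V E where
  nodes := s.nodes.filter (fun v => N.activeOut s v ≠ ∅)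
  links := s.links.filter (fun e =>
    ¬ (s.resCap e ≤ s.flow e) ∧ ¬ (N.head e ≠ N.dest ∧ N.head e ∉ s.nodes))
  flow := fun e => if N.tail e ∈ s.nodes ∧ e ∈ s.links then
      G.split (N.tail e) (N.activeOut s (N.tail e)) (N.currentInflow lam s (N.tail e)) e
    else 0
  resCap := fun e => s.resCap e - d e

/-- The trajectory under the disturbance process `δ 1, δ 2, …` (the value `δ 0` is not used). -/
def trajectory (G : N.RoutingPolicy) (lam : ℝ) (f₀ : E → ℝ) (δ : ℕ → E → ℝ) : ℕ → State V E
  | 0 => N.initState f₀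
  | t + 1 => N.nextState G lam (trajectory G lam f₀ δ t) (δ (t + 1))

/-- `δ 1, δ 2, …` is a disturbance process: nonnegative capacity reductions whose sums up to any
time do not exceed the capacities. -/
structure IsDisturbance (δ : ℕ → E → ℝ) : Prop where
  nonneg : ∀ t, 1 ≤ t → ∀ e, 0 ≤ δ t e
  sum_le : ∀ t e, ∑ s ∈ Finset.Icc 1 t, δ s e ≤ N.cap e

/-- The dynamics is transferring: the flow arriving at the destination tends to the inflow. -/
def IsTransferring (G : N.RoutingPolicy) (lam : ℝ) (f₀ : E → ℝ) (δ : ℕ → E → ℝ) : Prop :=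
  Tendsto (fun t => ∑ e ∈ N.inLinks N.dest, (N.trajectory G lam f₀ δ t).flow e) atTop (𝓝 lam)

end Network

/-- The magnitude of a disturbance process: the sum over all links of the total capacity reduction
over all times `t ≥ 1`. (For a disturbance process the series converge.) -/
def magnitude {E : Type*} [Fintype E] (δ : ℕ → E → ℝ) : ℝ := ∑ e, ∑' t, δ (t + 1) e

end CascadingFailure

end

namespace CascadingFailure.Network

/-! The proof has two halves: a disturbance smaller than the margin cannot make the origin inactive,
and an origin that stays active forces the transfer of all the inflow.

First half. In a directed tree a node other than the destination has at most one incoming link, so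
while the path to it is active its inflow is `lam` or the flow on that link. Active sets only
shrink; hence link and flow monotonicity make flows and inflows along a surviving path nondecreasing
in time. Suppose `v` becomes inactive while its path is active, with latest inflow `μ`. Each
outgoing link `e` carried, when it failed, at most what the policy prescribes for `μ` and the links
that had not failed before. It failed either from lack of capacity, at a cost of at least `C_e - x`
on `e` itself, or because its head became inactive, which by backward induction cost at least the
margin of the head below `e`. Margins decrease in the flow (`linkMargin_anti`), so the cost is at
least `S_e` at the prescribed flow. Summing in the order of failure along the BPA recursion gives
the margin of `v` (`margin_outLinks_le`, `margin_le_sum_sumBelow`); subtrees below different links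
out of a node are disjoint, so no disturbance is counted twice. At the origin this contradicts the
bound on the magnitude.

Second half. The active sets are eventually constant, so on a tree the flows become constant from
the origin downward. Mass balance then makes the flow into the destination equal to `lam`
(`sum_flow_succ_add`). -/

/-- A feasible vector can be lowered to a smaller total, staying above a smaller lower bound. -/
theorem exists_feasible_le {V E : Type*} [DecidableEq E] {N : Network V E} {J : Finset E}
    {r r' x' : E → ℝ} {μ μ' : ℝ}
    (hx' : x' ∈ N.feasible J r' μ') (hr : ∀ e ∈ J, 0 ≤ r e) (hrr : ∀ e ∈ J, r e ≤ r' e)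
    (hsum : ∑ e ∈ J, r e ≤ μ) (hμ : μ ≤ μ') :
    ∃ x ∈ N.feasible J r μ, ∀ e ∈ J, x e ≤ x' e := by
  -- The required vector is the point `r + θ (x' - r)` of the segment from `r` to `x'`, with `θ`
  -- fixed by the total `μ`. If the segment has constant total, then `∑ r = μ = μ'` and `θ = 0` will
  -- do.
  obtain ⟨θ, h0, h1, hθ⟩ : ∃ θ : ℝ, 0 ≤ θ ∧ θ ≤ 1 ∧
      ∑ e ∈ J, r e + θ * (μ' - ∑ e ∈ J, r e) = μ := by
    rcases (hsum.trans hμ).eq_or_lt with heq | hlt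
    · exact ⟨0, le_rfl, zero_le_one, by linarith⟩
    · have hpos := sub_pos.2 hlt
      refine ⟨(μ - ∑ e ∈ J, r e) / (μ' - ∑ e ∈ J, r e), div_nonneg (by linarith) hpos.le,
        (div_le_one hpos).2 (by linarith), ?_⟩
      rw [div_mul_cancel₀ _ hpos.ne']; ring
  have hle : ∀ e ∈ J, r e ≤ x' e := fun e he => (hrr e he).trans (hx'.1 e he).2.1
  have hlow : ∀ e ∈ J, r e ≤ r e + θ * (x' e - r e) := fun e he =>
    le_add_of_nonneg_right (mul_nonneg h0 (sub_nonneg.2 (hle e he)))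
  have hup : ∀ e ∈ J, r e + θ * (x' e - r e) ≤ x' e := fun e he => by
    have := mul_le_of_le_one_left (sub_nonneg.2 (hle e he)) h1
    linarith
  refine ⟨fun e => if e ∈ J then r e + θ * (x' e - r e) else 0, ⟨fun e he => ?_, fun e he => ?_, ?_⟩,
    fun e he => ?_⟩
  · simp only [if_pos he]
    exact ⟨(hr e he).trans (hlow e he), hlow e he, (hup e he).trans (hx'.1 e he).2.2⟩
  · simp [he]
  · rw [Finset.sum_congr rfl fun e he => if_pos he, Finset.sum_add_distrib, ← Finset.mul_sum,
      Finset.sum_sub_distrib, hx'.2.2, hθ]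
  · simp only [if_pos he]
    exact hup e he

/-! ### Bounds and monotonicity of the margins; failure costs at one node -/

section Margins

variable {V E : Type*} [Fintype V] [Fintype E] [DecidableEq V] [DecidableEq E] {N : Network V E}

/-- The function of `x` that is maximized in the recursive step at `J`. -/
noncomputable def stepValue (h : N.Acyclic) (J : Finset E) (hJ : J.Nonempty) (μ : ℝ) (x : E → ℝ) :
    ℝ :=
  J.attach.inf' hJ.attach (fun e => linkMargin h e.1 (x e.1) + margin h (J.erase e.1) x μ)

theorem stepValue_le (h : N.Acyclic) {J : Finset E} (hJ : J.Nonempty) (μ : ℝ) (x : E → ℝ) {e : E}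
    (he : e ∈ J) :
    stepValue h J hJ μ x ≤ linkMargin h e (x e) + margin h (J.erase e) x μ :=
  Finset.inf'_le (fun e : J => linkMargin h e.1 (x e.1) + margin h (J.erase e.1) x μ)
    (Finset.mem_attach J ⟨e, he⟩)

theorem le_stepValue (h : N.Acyclic) {J : Finset E} (hJ : J.Nonempty) {μ : ℝ} {x : E → ℝ} {a : ℝ}
    (ha : ∀ e ∈ J, a ≤ linkMargin h e (x e) + margin h (J.erase e) x μ) :
    a ≤ stepValue h J hJ μ x :=
  Finset.le_inf' _ _ fun e _ => ha e.1 e.2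

theorem margin_eq_sSup (h : N.Acyclic) {J : Finset E} (hJ : J.Nonempty) {r : E → ℝ} {μ : ℝ}
    (hX : (N.feasible J r μ).Nonempty) :
    margin h J r μ = sSup (stepValue h J hJ μ '' N.feasible J r μ) :=
  margin_eq h hJ hX

theorem margin_empty (h : N.Acyclic) (r : E → ℝ) (μ : ℝ) : margin h ∅ r μ = 0 := by
  rw [margin, setMargin, dif_neg Finset.not_nonempty_empty]

theorem margin_of_infeasible (h : N.Acyclic) {J : Finset E} {r : E → ℝ} {μ : ℝ}
    (hX : ¬ (N.feasible J r μ).Nonempty) : margin h J r μ = 0 := by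
  rw [margin, setMargin]
  split_ifs <;> rfl

theorem linkMargin_le (h : N.Acyclic) (e : E) (x : ℝ) : linkMargin h e x ≤ N.cap e - x := by
  unfold linkMargin
  split_ifs
  · exact le_rfl
  · exact min_le_left _ _

theorem stepValue_le_sum_cap_of_erase (h : N.Acyclic) {J : Finset E} (hJ : J.Nonempty) {r : E → ℝ}
    {μ : ℝ} (hle : ∀ e ∈ J, ∀ x, margin h (J.erase e) x μ ≤ ∑ k ∈ J.erase e, N.cap k) {x : E → ℝ}
    (hx : x ∈ N.feasible J r μ) : stepValue h J hJ μ x ≤ ∑ k ∈ J, N.cap k := by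
  obtain ⟨e, he⟩ := hJ
  have h1 := stepValue_le h ⟨e, he⟩ μ x he
  have h2 := linkMargin_le h e (x e)
  have h3 := (hx.1 e he).1
  have h4 := hle e he x
  have h5 := Finset.add_sum_erase J N.cap he
  linarith

/-- Gives the boundedness that a real `sSup` needs in order to dominate its elements. A link
contributes at most its capacity, and the remaining links are handled by induction. -/
theorem margin_le_sum_cap (h : N.Acyclic) (J : Finset E) (r : E → ℝ) (μ : ℝ) :
    margin h J r μ ≤ ∑ k ∈ J, N.cap k := by
  induction J using Finset.strongInduction generalizing r with
  | H J ih =>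
    have hpos : 0 ≤ ∑ k ∈ J, N.cap k := Finset.sum_nonneg fun e _ => (N.cap_pos e).le
    by_cases hJ : J.Nonempty
    · by_cases hX : (N.feasible J r μ).Nonempty
      · rw [margin_eq_sSup h hJ hX]
        refine csSup_le (hX.image _) ?_
        rintro _ ⟨x, hx, rfl⟩
        exact stepValue_le_sum_cap_of_erase h hJ
          (fun e he x => ih _ (Finset.erase_ssubset he) x) hx
      · rwa [margin_of_infeasible h hX]
    · rw [Finset.not_nonempty_iff_eq_empty.1 hJ, margin_empty]; simp

theorem stepValue_bddAbove (h : N.Acyclic) {J : Finset E} (hJ : J.Nonempty) (r : E → ℝ) (μ : ℝ) :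
    BddAbove (stepValue h J hJ μ '' N.feasible J r μ) := by
  refine ⟨∑ k ∈ J, N.cap k, ?_⟩
  rintro _ ⟨x, hx, rfl⟩
  exact stepValue_le_sum_cap_of_erase h hJ (fun e _ x => margin_le_sum_cap h _ x μ) hx

theorem stepValue_le_margin (h : N.Acyclic) {J : Finset E} (hJ : J.Nonempty) {r : E → ℝ} {μ : ℝ}
    {x : E → ℝ} (hx : x ∈ N.feasible J r μ) : stepValue h J hJ μ x ≤ margin h J r μ := by
  rw [margin_eq_sSup h hJ ⟨x, hx⟩]
  exact le_csSup (stepValue_bddAbove h hJ r μ) ⟨x, hx, rfl⟩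

theorem margin_le_of_mem_maximizers (h : N.Acyclic) {J : Finset E} {r : E → ℝ} {μ : ℝ} {x : E → ℝ}
    (hx : x ∈ maximizers h J r μ) {e : E} (he : e ∈ J) :
    margin h J r μ ≤ linkMargin h e (x e) + margin h (J.erase e) x μ := by
  obtain ⟨hf, hJ, hmax⟩ := hx
  refine le_trans ?_ (stepValue_le h hJ μ x he)
  rw [margin_eq_sSup h hJ ⟨x, hf⟩]
  refine csSup_le (Set.Nonempty.image _ ⟨x, hf⟩) ?_
  rintro _ ⟨y, hy, rfl⟩
  exact hmax hy

/-- The sign of the link margins is a hypothesis so that the lemma can serve inside the backward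
induction over nodes. -/
theorem margin_nonneg_of_linkMargin (h : N.Acyclic) (J : Finset E) (r : E → ℝ) (μ : ℝ)
    (hl : ∀ e ∈ J, ∀ x, x ≤ N.cap e → 0 ≤ linkMargin h e x) : 0 ≤ margin h J r μ := by
  induction J using Finset.strongInduction generalizing r with
  | H J ih =>
    by_cases hX : (N.feasible J r μ).Nonempty
    · by_cases hJ : J.Nonempty
      · rw [margin_eq_sSup h hJ hX]
        refine Real.sSup_nonneg ?_
        rintro _ ⟨x, hx, rfl⟩
        exact le_stepValue h hJ fun e he => add_nonneg (hl e he _ (hx.1 e he).2.2)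
          (ih _ (Finset.erase_ssubset he) x fun k hk => hl k (Finset.mem_of_mem_erase hk))
      · rw [Finset.not_nonempty_iff_eq_empty.1 hJ, margin_empty]
    · rw [margin_of_infeasible h hX]

theorem nodeMargin_nonneg (h : N.Acyclic) (v : V) (μ : ℝ) : 0 ≤ nodeMargin h v μ := by
  induction v using h.wf.induction generalizing μ with
  | _ v ih =>
    rw [nodeMargin_eq]
    refine margin_nonneg_of_linkMargin h _ _ _ fun e he x hx => ?_
    unfold linkMargin
    split_ifs
    · exact sub_nonneg.2 hx
    · exact le_min (sub_nonneg.2 hx) (ih _ ⟨e, by simpa [outLinks] using he, rfl⟩ x)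

theorem linkMargin_nonneg (h : N.Acyclic) {e : E} {x : ℝ} (hx : x ≤ N.cap e) :
    0 ≤ linkMargin h e x := by
  unfold linkMargin
  split_ifs
  · exact sub_nonneg.2 hx
  · exact le_min (sub_nonneg.2 hx) (nodeMargin_nonneg h _ x)

theorem margin_nonneg (h : N.Acyclic) (J : Finset E) (r : E → ℝ) (μ : ℝ) : 0 ≤ margin h J r μ :=
  margin_nonneg_of_linkMargin h J r μ fun _ _ _ hx => linkMargin_nonneg h hx

/-- A vector feasible for the larger data dominates one feasible for the smaller data, and every
term of the minimum is at least as large at the latter. The condition `∑ r ≤ μ` keeps the smaller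
problem feasible when the larger one is; otherwise its value could drop to the default `0`. -/
theorem margin_anti_of_linkMargin (h : N.Acyclic) (J : Finset E)
    (hl : ∀ e ∈ J, ∀ x y, 0 ≤ x → x ≤ y → linkMargin h e y ≤ linkMargin h e x)
    {r r' : E → ℝ} {μ μ' : ℝ} (hr : ∀ e ∈ J, 0 ≤ r e) (hrr : ∀ e ∈ J, r e ≤ r' e)
    (hsum : ∑ e ∈ J, r e ≤ μ) (hμ : μ ≤ μ') : margin h J r' μ' ≤ margin h J r μ := by
  induction J using Finset.strongInduction generalizing r r' with
  | H J ih =>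
    by_cases hX : (N.feasible J r' μ').Nonempty
    · by_cases hJ : J.Nonempty
      · rw [margin_eq_sSup h hJ hX]
        refine csSup_le (hX.image _) ?_
        rintro _ ⟨x', hx', rfl⟩
        obtain ⟨x, hx, hxx⟩ := exists_feasible_le hx' hr hrr hsum hμ
        refine le_trans (le_stepValue h hJ fun e he => ?_) (stepValue_le_margin h hJ hx)
        refine (stepValue_le h hJ μ' x' he).trans (add_le_add
          (hl e he _ _ (hx.1 e he).1 (hxx e he)) ?_)
        refine ih _ (Finset.erase_ssubset he) (fun k hk => hl k (Finset.mem_of_mem_erase hk))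
          (fun k hk => (hx.1 k (Finset.mem_of_mem_erase hk)).1)
          (fun k hk => hxx k (Finset.mem_of_mem_erase hk)) ?_
        have h1 := Finset.add_sum_erase J x he
        have h2 := (hx.1 e he).1
        have h3 := hx.2.2
        linarith
      · rw [Finset.not_nonempty_iff_eq_empty.1 hJ, margin_empty, margin_empty]
    · rw [margin_of_infeasible h hX]
      exact margin_nonneg h _ _ _

theorem linkMargin_anti_of_nodeMargin (h : N.Acyclic) (e : E) {x y : ℝ} (hxy : x ≤ y)
    (hn : nodeMargin h (N.head e) y ≤ nodeMargin h (N.head e) x) :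
    linkMargin h e y ≤ linkMargin h e x := by
  unfold linkMargin
  split_ifs
  · linarith
  · exact min_le_min (by linarith) hn

theorem nodeMargin_anti (h : N.Acyclic) (v : V) {x y : ℝ} (hx : 0 ≤ x) (hxy : x ≤ y) :
    nodeMargin h v y ≤ nodeMargin h v x := by
  induction v using h.wf.induction generalizing x y with
  | _ v ih =>
    rw [nodeMargin_eq, nodeMargin_eq]
    refine margin_anti_of_linkMargin h _ (fun e he a b ha hab => ?_) (fun _ _ => le_rfl)
      (fun _ _ => le_rfl) (by simpa using hx) hxy
    exact linkMargin_anti_of_nodeMargin h e hab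
      (ih _ ⟨e, by simpa [outLinks] using he, rfl⟩ ha hab)

theorem linkMargin_anti (h : N.Acyclic) (e : E) {x y : ℝ} (hx : 0 ≤ x) (hxy : x ≤ y) :
    linkMargin h e y ≤ linkMargin h e x :=
  linkMargin_anti_of_nodeMargin h e hxy (nodeMargin_anti h _ hx hxy)

/-- On one link the only possible feasible vector sends all of `μ` there, so the lower bound `r` has
no influence on the estimate. -/
theorem margin_singleton_le (h : N.Acyclic) {e : E} {r : E → ℝ} {μ b : ℝ} (hb : 0 ≤ b)
    (hle : linkMargin h e μ ≤ b) : margin h {e} r μ ≤ b := by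
  by_cases hX : (N.feasible {e} r μ).Nonempty
  · rw [margin_eq_sSup h (Finset.singleton_nonempty e) hX]
    refine csSup_le (hX.image _) ?_
    rintro _ ⟨x, hx, rfl⟩
    have h1 := stepValue_le h (Finset.singleton_nonempty e) μ x (Finset.mem_singleton_self e)
    have h2 : x e = μ := by simpa using hx.2.2
    have h3 : ({e} : Finset E).erase e = ∅ := by simp
    rw [h2, h3, margin_empty] at h1
    linarith
  · rwa [margin_of_infeasible h hX]

/-- Under BPA routing at a node with at most three outgoing links, if these links fail in the order
of the times `t` and the failure of `e` costs at least its margin under the flow that it carries,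
then the failure of all of them costs at least the margin of the node. -/
theorem RoutingPolicy.IsBPA.margin_outLinks_le {h : N.Acyclic} {G : N.RoutingPolicy}
    (hG : G.IsBPA h) {v : V} (hv : v ≠ N.dest) (hdeg : (N.outLinks v).card ≤ 3) {μ : ℝ}
    (hμ : 0 ≤ μ) (t : E → ℕ) {D : E → ℝ} (hD : ∀ e, 0 ≤ D e)
    (hcost : ∀ J ⊆ N.outLinks v, ∀ e ∈ J, (∀ k ∈ J, t e ≤ t k) →
      linkMargin h e (G.split v J μ e) ≤ D e) :
    margin h (N.outLinks v) 0 μ ≤ ∑ e ∈ N.outLinks v, D e := by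
  have hDs : ∀ J : Finset E, 0 ≤ ∑ e ∈ J, D e := fun J => Finset.sum_nonneg fun e _ => hD e
  -- The lower bound is arbitrary here: a single remaining link must carry all of `μ` under any
  -- policy.
  have base : ∀ J ⊆ N.outLinks v, J.card ≤ 1 → ∀ r, margin h J r μ ≤ ∑ e ∈ J, D e := by
    intro J hJ hc r
    rcases J.eq_empty_or_nonempty with rfl | hne
    · rw [margin_empty]; simp
    · obtain ⟨e, rfl⟩ := Finset.card_eq_one.1 (le_antisymm hc hne.card_pos)
      rw [Finset.sum_singleton]
      refine margin_singleton_le h (hD e) ?_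
      have h1 := hcost _ hJ e (Finset.mem_singleton_self e) (by simp)
      have h2 := G.sum_eq v hv _ hJ hne μ hμ
      rw [Finset.sum_singleton] at h2
      rwa [h2] at h1
  -- One level of the recursion: the minimum at the maximizer is bounded by its term for the link of
  -- `J` that fails first.
  have step : ∀ J ⊆ N.outLinks v, ∀ r,
      ((N.feasible J r μ).Nonempty → J.Nonempty → G.split v J μ ∈ maximizers h J r μ) →
      (∀ e ∈ J, margin h (J.erase e) (G.split v J μ) μ ≤ ∑ k ∈ J.erase e, D k) →
      margin h J r μ ≤ ∑ e ∈ J, D e := by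
    intro J hJ r hmax hrest
    rcases J.eq_empty_or_nonempty with rfl | hne
    · rw [margin_empty]; simp
    by_cases hX : (N.feasible J r μ).Nonempty
    · obtain ⟨e, he, hmin⟩ := J.exists_min_image t hne
      have h1 := margin_le_of_mem_maximizers h (hmax hX hne) he
      have h2 := hcost J hJ e he hmin
      have h3 := hrest e he
      have h4 := Finset.add_sum_erase J D he
      linarith
    · rw [margin_of_infeasible h hX]
      exact hDs J
  -- The recursion meets the lower bound `0`, then `r*`, exactly those for which BPA routing
  -- maximizes. At the next level its bound is the action on `J`, no longer `r*`; with at most three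
  -- links only one link is then left and `base` applies.
  refine step _ subset_rfl 0 (fun hX _ => (hG v hv μ hμ).1 hX) fun e he => ?_
  refine step _ (Finset.erase_subset _ _) _ (fun hX hne =>
    (hG v hv μ hμ).2 _ (Finset.erase_ssubset he) hne hX) fun k hk => ?_
  refine base _ ((Finset.erase_subset _ _).trans (Finset.erase_subset _ _)) ?_ _
  rw [Finset.card_erase_of_mem hk, Finset.card_erase_of_mem he]
  omega

end Margins

/-! ### Directed trees: unique incoming links and disjoint subtrees -/

section Tree

variable {V E : Type*} {N : Network V E}

theorem reflTransGen_step_origin (v : V) (hv : v ≠ N.dest) :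
    Relation.ReflTransGen N.Step N.origin v := by
  by_cases h : v = N.origin
  · rw [h]
  · exact (N.on_path v h hv).1

theorem head_ne_origin (e : E) : N.head e ≠ N.origin :=
  (N.origin_iff N.origin).2 rfl e

theorem ne_dest_of_reflTransGen_step {u w : V} (h : Relation.ReflTransGen N.Step u w)
    (hw : w ≠ N.dest) : u ≠ N.dest := by
  rintro rfl
  rcases Relation.ReflTransGen.cases_head h with h1 | ⟨_, ⟨e, h1, -⟩, -⟩
  · exact hw h1.symm
  · exact tail_ne_dest e h1

/-- A directed path in the tree that does not end below the head of `e` survives the deletion of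
`e`. -/
theorem IsTree.reachable_deleteEdges (h : N.IsTree) {e : E} (hd : N.head e ≠ N.dest) {u w : V}
    (huw : Relation.ReflTransGen N.Step u w) (hw : w ≠ N.dest)
    (hew : ¬ Relation.ReflTransGen N.Step (N.head e) w) (hu : u ≠ N.dest) :
    (N.coreGraph.deleteEdges {s(⟨N.tail e, tail_ne_dest e⟩, ⟨N.head e, hd⟩)}).Reachable
      ⟨u, hu⟩ ⟨w, hw⟩ := by
  induction huw using Relation.ReflTransGen.head_induction_on with
  | refl => exact SimpleGraph.Reachable.refl _
  | head h1 h2 ih =>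
    obtain ⟨e', rfl, rfl⟩ := h1
    have hc := ne_dest_of_reflTransGen_step h2 hw
    refine SimpleGraph.Reachable.trans (SimpleGraph.Adj.reachable ?_) (ih hc)
    rw [SimpleGraph.deleteEdges_adj, coreGraph, SimpleGraph.fromRel_adj]
    refine ⟨⟨fun hh => h.no_loop e' hc (congrArg Subtype.val hh), Or.inl ⟨e', rfl, rfl⟩⟩,
      fun hs => ?_⟩
    have hs' := congrArg (Sym2.map Subtype.val) (Set.mem_singleton_iff.1 hs)
    simp only [Sym2.map_mk] at hs'
    rw [h.no_parallel e' e hc hd hs'] at h2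
    exact hew h2

/-- In a directed tree, a node has at most one incoming link. -/
theorem IsTree.head_injective (h : N.IsTree) {e e' : E} (hd : N.head e ≠ N.dest)
    (hee : N.head e = N.head e') : e = e' := by
  by_contra hne
  have hd' : N.head e' ≠ N.dest := hee ▸ hd
  have hnot : ∀ k, N.head e = N.head k → ¬ Relation.ReflTransGen N.Step (N.head e) (N.tail k) :=
    fun k hk hp => h.acyclic _ (Relation.TransGen.tail' hp ⟨k, rfl, hk.symm⟩)
  have key : ∀ k, N.head e = N.head k →
      (N.coreGraph.deleteEdges {s(⟨N.tail e, tail_ne_dest e⟩, ⟨N.head e, hd⟩)}).Reachable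
        ⟨N.origin, N.origin_ne_dest⟩ ⟨N.tail k, tail_ne_dest k⟩ := fun k hk =>
    h.reachable_deleteEdges hd (reflTransGen_step_origin _ (tail_ne_dest k)) _ (hnot k hk) _
  have hadj : N.coreGraph.Adj ⟨N.tail e, tail_ne_dest e⟩ ⟨N.head e, hd⟩ := by
    rw [coreGraph, SimpleGraph.fromRel_adj]
    exact ⟨fun hh => h.no_loop e hd (congrArg Subtype.val hh), Or.inl ⟨e, rfl, rfl⟩⟩
  have hb := SimpleGraph.isAcyclic_iff_forall_adj_isBridge.1 h.isTree.isAcyclic hadj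
  rw [SimpleGraph.isBridge_iff] at hb
  -- Back from the tail of `e` to the origin, on to the tail of `e'` and across `e'`: a detour that
  -- avoids `e`, although `e` is a bridge.
  refine hb ((key e rfl).symm.trans ((key e' hee).trans (SimpleGraph.Adj.reachable ?_)))
  rw [SimpleGraph.deleteEdges_adj, coreGraph, SimpleGraph.fromRel_adj]
  refine ⟨⟨fun hh => h.no_loop e' hd' ((congrArg Subtype.val hh).trans hee),
    Or.inl ⟨e', rfl, hee.symm⟩⟩, fun hs => ?_⟩
  have hs' := congrArg (Sym2.map Subtype.val) (Set.mem_singleton_iff.1 hs)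
  simp only [Sym2.map_mk] at hs'
  refine hne (h.no_parallel e e' hd hd' ?_)
  rw [← hs', hee]

/-- The link `k` lies on a directed path that starts with the link `e`. -/
def Below (N : Network V E) (e k : E) : Prop :=
  Relation.ReflTransGen (fun a b => N.head a = N.tail b) e k

theorem Below.reflTransGen_step {e k : E} (h : N.Below e k) :
    Relation.ReflTransGen N.Step (N.tail e) (N.tail k) := by
  induction h with
  | refl => exact Relation.ReflTransGen.refl
  | tail _ h2 ih => exact ih.tail ⟨_, rfl, h2⟩

/-- In a directed tree, no link is below two different links going out of the same node. -/
theorem IsTree.eq_of_below (h : N.IsTree) {e e' k : E} (ht : N.tail e = N.tail e')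
    (hk : N.Below e k) (hk' : N.Below e' k) : e = e' := by
  have main : ∀ {a b : E}, N.tail a = N.tail b → N.Below a b → a = b := by
    intro a b hab hbel
    rcases Relation.ReflTransGen.cases_tail hbel with h1 | ⟨c, h1, h2⟩
    · exact h1.symm
    · have h3 : Relation.ReflTransGen N.Step (N.tail a) (N.tail c) := Below.reflTransGen_step h1
      exact (h.acyclic _ (Relation.TransGen.tail' h3 ⟨c, rfl, h2.trans hab.symm⟩)).elim
  -- Going backward from `k` is deterministic, so one of `e`, `e'` is below the other; having the
  -- same tail, they would otherwise close a directed cycle.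
  have huniq : Relator.RightUnique (Function.swap fun a b : E => N.head a = N.tail b) :=
    fun a b c hab hac => h.head_injective (hab.trans_ne (tail_ne_dest a)) (hab.trans hac.symm)
  rcases Relation.ReflTransGen.total_of_right_unique huniq
    (Relation.reflTransGen_swap.2 hk) (Relation.reflTransGen_swap.2 hk') with h1 | h1
  · exact (main ht.symm (Relation.reflTransGen_swap.1 h1)).symm
  · exact main ht (Relation.reflTransGen_swap.1 h1)

open Classical in
/-- The total of `d` over all links below `e`. -/
noncomputable def sumBelow [Fintype E] (N : Network V E) (d : E → ℝ) (e : E) : ℝ :=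
  ∑ k with N.Below e k, d k

theorem sumBelow_nonneg [Fintype E] {d : E → ℝ} (hd : ∀ e, 0 ≤ d e) (e : E) :
    0 ≤ N.sumBelow d e :=
  Finset.sum_nonneg fun k _ => hd k

theorem le_sumBelow [Fintype E] {d : E → ℝ} (hd : ∀ e, 0 ≤ d e) (e : E) :
    d e ≤ N.sumBelow d e := by
  classical
  refine Finset.single_le_sum (f := d) (fun k _ => hd k) ?_
  exact Finset.mem_filter.2 ⟨Finset.mem_univ e, Relation.ReflTransGen.refl⟩

/-- Sums of `sumBelow` over links going out of one node count every link at most once. -/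
theorem IsTree.sum_sumBelow_le [Fintype E] (h : N.IsTree) {d : E → ℝ} (hd : ∀ e, 0 ≤ d e)
    {J : Finset E} {v : V} (hJ : ∀ e ∈ J, N.tail e = v) {s : Finset E}
    (hs : ∀ e ∈ J, ∀ k, N.Below e k → k ∈ s) : ∑ e ∈ J, N.sumBelow d e ≤ ∑ k ∈ s, d k := by
  classical
  have hdisj : (J : Set E).PairwiseDisjoint fun e => Finset.univ.filter fun k => N.Below e k := by
    intro e he e' he' hne
    refine Finset.disjoint_left.2 fun k hk hk' => hne ?_
    exact h.eq_of_below ((hJ e he).trans (hJ e' he').symm) (Finset.mem_filter.1 hk).2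
      (Finset.mem_filter.1 hk').2
  calc ∑ e ∈ J, N.sumBelow d e = ∑ e ∈ J, ∑ k with N.Below e k, d k :=
        Finset.sum_congr rfl fun e _ => by unfold sumBelow; congr
    _ = ∑ k ∈ J.biUnion fun e => Finset.univ.filter fun k => N.Below e k, d k :=
        (Finset.sum_biUnion hdisj).symm
    _ ≤ ∑ k ∈ s, d k := by
        refine Finset.sum_le_sum_of_subset_of_nonneg (fun k hk => ?_) fun k _ _ => hd k
        obtain ⟨e, he, hk⟩ := Finset.mem_biUnion.1 hk
        exact hs e he k (Finset.mem_filter.1 hk).2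

theorem IsTree.sum_sumBelow_le_sumBelow [Fintype E] (h : N.IsTree) {d : E → ℝ}
    (hd : ∀ e, 0 ≤ d e) {J : Finset E} {e : E} (hJ : ∀ k ∈ J, N.tail k = N.head e) :
    ∑ k ∈ J, N.sumBelow d k ≤ N.sumBelow d e := by
  classical
  refine h.sum_sumBelow_le hd hJ fun k hk l hl => ?_
  exact Finset.mem_filter.2 ⟨Finset.mem_univ l,
    Relation.ReflTransGen.head (hJ k hk).symm hl⟩

end Tree

/-! ### Basic properties of the trajectory -/

section Dynamics

set_option linter.unusedSectionVars false

variable {V E : Type*} [Fintype V] [Fintype E] [DecidableEq V] [DecidableEq E] {N : Network V E}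
  {G : N.RoutingPolicy} {lam : ℝ} {f₀ : E → ℝ} {δ : ℕ → E → ℝ}

@[simp] theorem mem_outLinks {v : V} {e : E} : e ∈ N.outLinks v ↔ N.tail e = v := by
  simp [outLinks]

@[simp] theorem mem_inLinks {v : V} {e : E} : e ∈ N.inLinks v ↔ N.head e = v := by
  simp [inLinks]

@[simp] theorem mem_activeOut {s : State V E} {v : V} {e : E} :
    e ∈ N.activeOut s v ↔ N.tail e = v ∧ e ∈ s.links := by
  simp [activeOut]

theorem activeOut_subset (s : State V E) (v : V) : N.activeOut s v ⊆ N.outLinks v :=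
  Finset.inter_subset_left

theorem links_antitone : Antitone fun t => (N.trajectory G lam f₀ δ t).links :=
  antitone_nat_of_succ_le fun _ => Finset.filter_subset _ _

theorem nodes_antitone : Antitone fun t => (N.trajectory G lam f₀ δ t).nodes :=
  antitone_nat_of_succ_le fun _ => Finset.filter_subset _ _

/-- A node is removed only when it had no active outgoing link one step earlier, and links never
return. Thus the flow update depends only on whether the link is active. -/
theorem tail_mem_nodes {t : ℕ} {e : E} (he : e ∈ (N.trajectory G lam f₀ δ t).links) :
    N.tail e ∈ (N.trajectory G lam f₀ δ t).nodes := by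
  induction t with
  | zero => simp [trajectory, initState, tail_ne_dest]
  | succ t ih =>
    have he' := links_antitone (Nat.le_succ t) he
    exact Finset.mem_filter.2 ⟨ih he',
      Finset.nonempty_iff_ne_empty.1 ⟨e, mem_activeOut.2 ⟨rfl, he'⟩⟩⟩

theorem flow_succ {t : ℕ} {e : E} (he : e ∈ (N.trajectory G lam f₀ δ t).links) :
    (N.trajectory G lam f₀ δ (t + 1)).flow e =
      G.split (N.tail e) (N.activeOut (N.trajectory G lam f₀ δ t) (N.tail e))
        (N.currentInflow lam (N.trajectory G lam f₀ δ t) (N.tail e)) e :=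
  if_pos ⟨tail_mem_nodes he, he⟩

theorem flow_succ_eq_zero {t : ℕ} {e : E} (he : e ∉ (N.trajectory G lam f₀ δ t).links) :
    (N.trajectory G lam f₀ δ (t + 1)).flow e = 0 :=
  if_neg fun h => he h.2

theorem resCap_eq (t : ℕ) (e : E) : (N.trajectory G lam f₀ δ t).resCap e =
    N.cap e - ∑ s ∈ Finset.range t, δ (s + 1) e := by
  induction t with
  | zero => simp [trajectory, initState]
  | succ t ih =>
    rw [Finset.sum_range_succ, ← sub_sub, ← ih]
    rfl

theorem currentInflow_nonneg (hlam : 0 ≤ lam) {s : State V E} (hs : ∀ e, 0 ≤ s.flow e) (v : V) :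
    0 ≤ N.currentInflow lam s v := by
  refine add_nonneg ?_ (Finset.sum_nonneg fun e _ => hs e)
  unfold extInflow
  split_ifs
  · exact hlam
  · exact le_rfl

theorem flow_nonneg (hlam : 0 ≤ lam) (hf₀ : N.IsInitialFlow G lam f₀) (t : ℕ) (e : E) :
    0 ≤ (N.trajectory G lam f₀ δ t).flow e := by
  induction t generalizing e with
  | zero => exact hf₀.nonneg e
  | succ t ih =>
    by_cases he : e ∈ (N.trajectory G lam f₀ δ t).links
    · rw [flow_succ he]
      exact G.nonneg _ (tail_ne_dest e) _ (activeOut_subset _ _)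
        ⟨e, mem_activeOut.2 ⟨rfl, he⟩⟩ _ (currentInflow_nonneg hlam ih _) e
    · rw [flow_succ_eq_zero he]

/-- Everything is active at time `0`, so the first update reproduces the initial flow. This lets
`flow_succ` cover time `0` as well. -/
theorem flow_one (hf₀ : N.IsInitialFlow G lam f₀) (e : E) :
    (N.trajectory G lam f₀ δ 1).flow e = f₀ e := by
  rw [flow_succ (t := 0) (by simp [trajectory, initState]),
    hf₀.routed _ (tail_ne_dest e) e (by simp)]
  simp [trajectory, initState, activeOut, currentInflow]

theorem currentInflow_origin (s : State V E) : N.currentInflow lam s N.origin = lam := by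
  have h : N.inLinks N.origin = ∅ :=
    Finset.eq_empty_of_forall_notMem fun e he => head_ne_origin e (mem_inLinks.1 he)
  simp [currentInflow, extInflow, h]

theorem IsTree.currentInflow_head (h : N.IsTree) {s : State V E} {e : E}
    (hd : N.head e ≠ N.dest) (he : e ∈ s.links) :
    N.currentInflow lam s (N.head e) = s.flow e := by
  have h1 : N.inLinks (N.head e) ∩ s.links = {e} := by
    ext k
    simp only [Finset.mem_inter, mem_inLinks, Finset.mem_singleton]
    constructor
    · rintro ⟨hk, -⟩
      exact (h.head_injective hd hk.symm).symm
    · rintro rfl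
      exact ⟨rfl, he⟩
  simp [currentInflow, extInflow, h1, head_ne_origin]

/-! ### Active paths and monotonicity in time -/

/-- There is a path of active links from the origin to `v`. -/
def PathActive (N : Network V E) (s : State V E) (v : V) : Prop :=
  Relation.ReflTransGen (fun u w => ∃ e ∈ s.links, N.tail e = u ∧ N.head e = w) N.origin v

theorem PathActive.mono {s s' : State V E} (hs : s'.links ⊆ s.links) {v : V}
    (hv : N.PathActive s' v) : N.PathActive s v :=
  Relation.ReflTransGen.mono (fun _ _ ⟨e, he, h1⟩ => ⟨e, hs he, h1⟩) _ _ hv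

theorem PathActive.head {s : State V E} {e : E} (hp : N.PathActive s (N.tail e))
    (he : e ∈ s.links) : N.PathActive s (N.head e) :=
  Relation.ReflTransGen.tail hp ⟨e, he, rfl, rfl⟩

theorem PathActive.eq_origin_or {s : State V E} {v : V} (hp : N.PathActive s v) :
    v = N.origin ∨ ∃ e ∈ s.links, N.head e = v ∧ N.PathActive s (N.tail e) := by
  rcases Relation.ReflTransGen.cases_tail hp with h1 | ⟨u, hu, e, he, rfl, rfl⟩
  · exact Or.inl h1
  · exact Or.inr ⟨e, he, rfl, hu⟩

/-- Monotonicity of the inflow at `v` follows from monotonicity of the flow on an active link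
into `v`. -/
theorem IsTree.currentInflow_le (h : N.IsTree) {s s' s'' : State V E} {v : V} (hv : v ≠ N.dest)
    (hp : N.PathActive s'' v) (hs : s''.links ⊆ s.links) (hs' : s''.links ⊆ s'.links)
    (hle : ∀ e ∈ s''.links, N.PathActive s'' (N.tail e) → s.flow e ≤ s'.flow e) :
    N.currentInflow lam s v ≤ N.currentInflow lam s' v := by
  rcases hp.eq_origin_or with rfl | ⟨e, he, rfl, hpe⟩
  · rw [currentInflow_origin, currentInflow_origin]
  · rw [h.currentInflow_head hv (hs he), h.currentInflow_head hv (hs' he)]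
    exact hle e he hpe

/-- Combines link and flow monotonicity. Flow monotonicity is not available at the origin, but the
inflow there is constant. -/
theorem split_le_split (hmono : G.FlowMonotone) {v : V} (hv : v ≠ N.dest) {J K : Finset E}
    (hJ : J ⊆ N.outLinks v) (hK : K ⊆ J) {μ μ' : ℝ} (hμ : 0 ≤ μ) (hμ' : μ ≤ μ')
    (ho : v = N.origin → μ = μ') {e : E} (he : e ∈ K) : G.split v J μ e ≤ G.split v K μ' e := by
  refine (G.link_mono v hv J hJ K hK ⟨e, he⟩ μ hμ e he).trans ?_
  by_cases hvo : v = N.origin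
  · rw [ho hvo]
  · exact hmono v hvo hv K (hK.trans hJ) ⟨e, he⟩ μ μ' hμ hμ' e he

/-- Induction on time: the set of active links shrinks, and the inflow at the tail does not
decrease, being `lam` or the flow on one link that is itself active up to `T`. -/
theorem IsTree.flow_le_succ (h : N.IsTree) (hlam : 0 ≤ lam) (hmono : G.FlowMonotone)
    (hf₀ : N.IsInitialFlow G lam f₀) {T t : ℕ} (ht : t + 1 ≤ T) {e : E}
    (he : e ∈ (N.trajectory G lam f₀ δ T).links)
    (hp : N.PathActive (N.trajectory G lam f₀ δ T) (N.tail e)) :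
    (N.trajectory G lam f₀ δ t).flow e ≤ (N.trajectory G lam f₀ δ (t + 1)).flow e := by
  induction t generalizing e with
  | zero => rw [zero_add, flow_one hf₀]; exact le_rfl
  | succ t ih =>
    have hs : ∀ {s}, s ≤ T → (N.trajectory G lam f₀ δ T).links ⊆
      (N.trajectory G lam f₀ δ s).links := fun hsT => links_antitone hsT
    rw [flow_succ (hs (by omega) he), flow_succ (hs (by omega) he)]
    refine split_le_split hmono (tail_ne_dest e) (activeOut_subset _ _)
      (Finset.inter_subset_inter_left (links_antitone (Nat.le_succ t)))
      (currentInflow_nonneg hlam (flow_nonneg hlam hf₀ _) _) ?_ (fun ho => ?_)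
      (mem_activeOut.2 ⟨rfl, hs (by omega) he⟩)
    · exact h.currentInflow_le (tail_ne_dest e) hp (hs (by omega)) (hs (by omega))
        fun k hk hpk => ih (by omega) hk hpk
    · rw [ho, currentInflow_origin, currentInflow_origin]

theorem IsTree.inflow_mono (h : N.IsTree) (hlam : 0 ≤ lam) (hmono : G.FlowMonotone)
    (hf₀ : N.IsInitialFlow G lam f₀) {T t : ℕ} (ht : t ≤ T) {v : V} (hv : v ≠ N.dest)
    (hp : N.PathActive (N.trajectory G lam f₀ δ T) v) :
    N.currentInflow lam (N.trajectory G lam f₀ δ t) v ≤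
      N.currentInflow lam (N.trajectory G lam f₀ δ T) v := by
  refine h.currentInflow_le hv hp (links_antitone ht) subset_rfl fun e he hpe => ?_
  have hle : ∀ s, t ≤ s → s ≤ T →
      (N.trajectory G lam f₀ δ t).flow e ≤ (N.trajectory G lam f₀ δ s).flow e := by
    intro s hs
    induction s, hs using Nat.le_induction with
    | base => exact fun _ => le_rfl
    | succ s _ ih => exact fun hsT =>
        (ih (by omega)).trans (h.flow_le_succ hlam hmono hf₀ hsT he hpe)
  exact hle T ht le_rfl

/-- As long as all links on the path to a node are active, the flows out of it are bounded by what
the policy prescribes for its latest inflow and any set of links that are still active. -/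
theorem IsTree.flow_le_split (h : N.IsTree) (hlam : 0 ≤ lam) (hmono : G.FlowMonotone)
    (hf₀ : N.IsInitialFlow G lam f₀) {T t : ℕ} (ht : t ≤ T) {v : V} (hv : v ≠ N.dest)
    (hp : N.PathActive (N.trajectory G lam f₀ δ T) v) {J : Finset E} {e : E} (he : e ∈ J)
    (hJ : J ⊆ N.activeOut (N.trajectory G lam f₀ δ t) v) :
    (N.trajectory G lam f₀ δ t).flow e ≤
      G.split v J (N.currentInflow lam (N.trajectory G lam f₀ δ T) v) e := by
  have htail : N.tail e = v := (mem_activeOut.1 (hJ he)).1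
  have hle : ∀ s, s ≤ T → J ⊆ N.activeOut (N.trajectory G lam f₀ δ s) v →
      (N.trajectory G lam f₀ δ (s + 1)).flow e ≤
        G.split v J (N.currentInflow lam (N.trajectory G lam f₀ δ T) v) e := by
    intro s hs hJs
    rw [flow_succ (mem_activeOut.1 (hJs he)).2, htail]
    refine split_le_split hmono hv (activeOut_subset _ _) hJs
      (currentInflow_nonneg hlam (flow_nonneg hlam hf₀ _) _)
      (h.inflow_mono hlam hmono hf₀ hs hv hp) (fun ho => ?_) he
    rw [ho, currentInflow_origin, currentInflow_origin]
  -- The flow at a positive time is computed from the preceding state, where the links of `J` were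
  -- active too; at time `0` it equals the flow at time `1`.
  rcases t with _ | t
  · have h1 := hle 0 ht hJ
    rwa [zero_add, flow_one hf₀] at h1
  · exact hle t (by omega) (hJ.trans
      (Finset.inter_subset_inter_left (links_antitone (Nat.le_succ t))))

theorem exists_lt_and_not_succ {p : ℕ → Prop} (h0 : p 0) {T : ℕ} (hT : ¬ p T) :
    ∃ t < T, p t ∧ ¬ p (t + 1) := by
  by_contra! hne
  have : ∀ t ≤ T, p t := by
    intro t
    induction t with
    | zero => exact fun _ => h0
    | succ t ih => exact fun ht => hne t ht (ih (by omega))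
  exact hT (this T le_rfl)

/-- If a node becomes inactive while the path to it is active, then the links below it have suffered
disturbances of at least the margin of the node. -/
theorem IsTree.margin_le_sum_sumBelow (h : N.IsTree)
    (hdeg : ∀ v, v ≠ N.dest → (N.outLinks v).card ≤ 3) (hlam : 0 ≤ lam) (hG : G.IsBPA h.acyclic)
    (hmono : G.FlowMonotone) (hf₀ : N.IsInitialFlow G lam f₀) {d : E → ℝ} (hd : ∀ e, 0 ≤ d e)
    (hres : ∀ t e, N.cap e - d e ≤ (N.trajectory G lam f₀ δ t).resCap e) {v : V} (hv : v ≠ N.dest)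
    {T : ℕ} (hp : N.PathActive (N.trajectory G lam f₀ δ T) v)
    (hvT : v ∉ (N.trajectory G lam f₀ δ T).nodes) :
    margin h.acyclic (N.outLinks v) 0 (N.currentInflow lam (N.trajectory G lam f₀ δ T) v) ≤
      ∑ e ∈ N.outLinks v, N.sumBelow d e := by
  induction v using h.acyclic.wf.induction generalizing T with
  | _ v ih =>
    -- `T'` is the step at which `v` is dropped, so all its outgoing links are already inactive at
    -- `T'`.
    obtain ⟨T', hT', hvT', hvT''⟩ := exists_lt_and_not_succ
      (p := fun t => v ∈ (N.trajectory G lam f₀ δ t).nodes)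
      (by simpa [trajectory, initState] using hv) hvT
    have hempty : ∀ e ∈ N.outLinks v, e ∉ (N.trajectory G lam f₀ δ T').links := fun e he he' =>
      hvT'' (Finset.mem_filter.2 ⟨hvT', Finset.nonempty_iff_ne_empty.1
        ⟨e, mem_activeOut.2 ⟨mem_outLinks.1 he, he'⟩⟩⟩)
    have hfail : ∀ e ∈ N.outLinks v, ∃ t < T', e ∈ (N.trajectory G lam f₀ δ t).links ∧
        e ∉ (N.trajectory G lam f₀ δ (t + 1)).links := fun e he => exists_lt_and_not_succ
      (p := fun t => e ∈ (N.trajectory G lam f₀ δ t).links)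
      (by simp [trajectory, initState]) (hempty e he)
    choose! t ht hmem hnot using hfail
    refine hG.margin_outLinks_le hv (hdeg v hv)
      (currentInflow_nonneg hlam (flow_nonneg hlam hf₀ _) _) t (sumBelow_nonneg hd)
      fun J hJ e he hmin => ?_
    have hev := hJ he
    have htT : t e ≤ T := by have := ht e hev; omega
    have htail := mem_outLinks.1 hev
    -- The links of `J` fail no earlier than `e`, hence all are still active at time `t e`.
    have hflow : (N.trajectory G lam f₀ δ (t e)).flow e ≤
        G.split v J (N.currentInflow lam (N.trajectory G lam f₀ δ T) v) e :=
      h.flow_le_split hlam hmono hf₀ htT hv hp he fun k hk =>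
        mem_activeOut.2 ⟨mem_outLinks.1 (hJ hk), links_antitone (hmin k hk) (hmem k (hJ hk))⟩
    refine (linkMargin_anti h.acyclic e (flow_nonneg hlam hf₀ _ _) hflow).trans ?_
    have hcause : (N.trajectory G lam f₀ δ (t e)).resCap e ≤
        (N.trajectory G lam f₀ δ (t e)).flow e ∨
        N.head e ≠ N.dest ∧ N.head e ∉ (N.trajectory G lam f₀ δ (t e)).nodes := by
      by_contra hc
      rw [not_or] at hc
      exact hnot e hev (Finset.mem_filter.2 ⟨hmem e hev, hc⟩)
    rcases hcause with hc | ⟨hhd, hc⟩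
    · have h1 := linkMargin_le h.acyclic e ((N.trajectory G lam f₀ δ (t e)).flow e)
      have h2 := hres (t e) e
      have h3 := le_sumBelow (N := N) hd e
      linarith
    · have hpe : N.PathActive (N.trajectory G lam f₀ δ (t e)) (N.tail e) :=
        htail ▸ hp.mono (links_antitone htT)
      -- At time `t e` the link `e` is still active, so the path to its head is active and the
      -- inflow there is the flow on `e`.
      have h1 := ih (N.head e) ⟨e, htail, rfl⟩ hhd (hpe.head (hmem e hev)) hc
      rw [h.currentInflow_head hhd (hmem e hev), ← nodeMargin_eq] at h1
      rw [linkMargin, if_neg hhd]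
      exact (min_le_right _ _).trans (h1.trans (h.sum_sumBelow_le_sumBelow hd fun k hk =>
        mem_outLinks.1 hk))

/-- The origin remains active if the disturbance is smaller than the margin of the origin. -/
theorem IsTree.origin_mem_nodes (h : N.IsTree)
    (hdeg : ∀ v, v ≠ N.dest → (N.outLinks v).card ≤ 3) (hlam : 0 ≤ lam) (hG : G.IsBPA h.acyclic)
    (hmono : G.FlowMonotone) (hf₀ : N.IsInitialFlow G lam f₀) (hδ : N.IsDisturbance δ)
    (hsmall : magnitude δ < upperMargin h.acyclic lam) (T : ℕ) :
    N.origin ∈ (N.trajectory G lam f₀ δ T).nodes := by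
  by_contra hT
  have hnn : ∀ e s, 0 ≤ δ (s + 1) e := fun e s => hδ.nonneg _ (by omega) e
  have hsum : ∀ e, Summable fun s => δ (s + 1) e := fun e => by
    refine summable_of_sum_range_le (c := N.cap e) (hnn e) fun t => ?_
    refine le_trans (le_of_eq ?_) (hδ.sum_le t e)
    rw [Finset.range_eq_Ico, Finset.sum_Ico_add' (fun s => δ s e) 0 t 1]
    rfl
  have hd : ∀ e, 0 ≤ ∑' s, δ (s + 1) e := fun e => tsum_nonneg (hnn e)
  -- Here `d e` is the total reduction on `e` over all times, which dominates the reduction up to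
  -- any time.
  have h1 := h.margin_le_sum_sumBelow hdeg hlam hG hmono hf₀ hd (fun t e => ?_) N.origin_ne_dest
    Relation.ReflTransGen.refl hT
  · rw [currentInflow_origin] at h1
    have h2 := h.sum_sumBelow_le hd (J := N.outLinks N.origin) (fun e he => mem_outLinks.1 he)
      (s := Finset.univ) fun _ _ k _ => Finset.mem_univ k
    exact absurd (h1.trans h2) (not_le.2 hsmall)
  · rw [resCap_eq]
    exact sub_le_sub_left ((hsum e).sum_le_tsum _ fun s _ => hnn e s) _

theorem exists_forall_eq_of_antitone {α : Type*} [PartialOrder α] [WellFoundedLT α] {a : ℕ → α}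
    (ha : Antitone a) : ∃ T, ∀ t ≥ T, a t = a T := by
  obtain ⟨T, hT⟩ := WellFoundedGT.monotone_chain_condition (α := αᵒᵈ)
    ⟨fun t => OrderDual.toDual (a t), ha⟩
  exact ⟨T, fun t ht => (hT t ht).symm⟩

end Dynamics

/-! ### Stationary regime and mass balance -/

section Limit

variable {V E : Type*} [Fintype V] [Fintype E] [DecidableEq V] [DecidableEq E] {N : Network V E}
  {G : N.RoutingPolicy} {lam : ℝ} {f₀ : E → ℝ} {δ : ℕ → E → ℝ}

theorem eventually_flow_eq_of_currentInflow {L : Finset E} {T₀ : ℕ}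
    (hL : ∀ t ≥ T₀, (N.trajectory G lam f₀ δ t).links = L) {e : E}
    (hc : ∃ c T, ∀ t ≥ T, N.currentInflow lam (N.trajectory G lam f₀ δ t) (N.tail e) = c) :
    ∃ c T, ∀ t ≥ T, (N.trajectory G lam f₀ δ t).flow e = c := by
  obtain ⟨c, T, hc⟩ := hc
  have hpred : ∀ t ≥ max T T₀ + 1, ∃ s, t = s + 1 ∧ T ≤ s ∧ T₀ ≤ s := fun t ht =>
    ⟨t - 1, by omega, by omega, by omega⟩
  by_cases he : e ∈ L
  · refine ⟨G.split (N.tail e) (N.outLinks (N.tail e) ∩ L) c e, max T T₀ + 1, fun t ht => ?_⟩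
    obtain ⟨s, rfl, hs, hs₀⟩ := hpred t ht
    rw [flow_succ (by rwa [hL s hs₀]), hc s hs, activeOut, hL s hs₀]
  · refine ⟨0, max T T₀ + 1, fun t ht => ?_⟩
    obtain ⟨s, rfl, -, hs₀⟩ := hpred t ht
    exact flow_succ_eq_zero (by rwa [hL s hs₀])

/-- Constancy spreads along the path from the origin: the only link into a node either is eventually
active with eventually constant flow, or contributes nothing. -/
theorem IsTree.eventually_currentInflow_eq (h : N.IsTree) {L : Finset E} {T₀ : ℕ}
    (hL : ∀ t ≥ T₀, (N.trajectory G lam f₀ δ t).links = L) {v : V} (hv : v ≠ N.dest) :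
    ∃ c T, ∀ t ≥ T, N.currentInflow lam (N.trajectory G lam f₀ δ t) v = c := by
  induction reflTransGen_step_origin v hv with
  | refl => exact ⟨lam, 0, fun t _ => currentInflow_origin _⟩
  | tail _ hs ih =>
    obtain ⟨e, rfl, rfl⟩ := hs
    by_cases he : e ∈ L
    · obtain ⟨c, T, hc⟩ := eventually_flow_eq_of_currentInflow hL (ih (tail_ne_dest e))
      refine ⟨c, max T T₀, fun t ht => ?_⟩
      rw [h.currentInflow_head hv (by rwa [hL t (by omega)]), hc t (by omega)]
    · refine ⟨0, T₀, fun t ht => ?_⟩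
      have hempty : N.inLinks (N.head e) ∩ L = ∅ := by
        refine Finset.eq_empty_of_forall_notMem fun k hk => he ?_
        rw [Finset.mem_inter, mem_inLinks] at hk
        rw [h.head_injective hv hk.1.symm]
        exact hk.2
      simp [currentInflow, extInflow, head_ne_origin, hL t ht, hempty]

/-- The total flow on the active links in the stationary regime of the active sets. -/
theorem sum_flow_succ_add (hlam : 0 ≤ lam) (hf₀ : N.IsInitialFlow G lam f₀) {L : Finset E}
    {W : Finset V} {T₀ t : ℕ} (hL : ∀ t ≥ T₀, (N.trajectory G lam f₀ δ t).links = L)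
    (hW : ∀ t ≥ T₀, (N.trajectory G lam f₀ δ t).nodes = W) (ho : N.origin ∈ W) (ht : T₀ < t) :
    ∑ e ∈ L, (N.trajectory G lam f₀ δ (t + 1)).flow e +
        ∑ e ∈ N.inLinks N.dest, (N.trajectory G lam f₀ δ t).flow e =
      lam + ∑ e ∈ L, (N.trajectory G lam f₀ δ t).flow e := by
  set s := N.trajectory G lam f₀ δ t with hs
  have hsL : s.links = L := hL t ht.le
  have hsW : s.nodes = W := hW t ht.le
  have hsucc : N.trajectory G lam f₀ δ (t + 1) = N.nextState G lam s (δ (t + 1)) := rfl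
  have htail : ∀ e ∈ L, N.tail e ∈ W := fun e he => by
    rw [← hsW]; exact tail_mem_nodes (hsL.symm ▸ he)
  -- A link of `L` survives the next step, which excludes an inactive head. Likewise a node of `W`
  -- survives, so it has an active outgoing link and passes on all its inflow.
  have hhead : ∀ e ∈ L, N.head e ≠ N.dest → N.head e ∈ W := by
    intro e he hd
    rw [← hL (t + 1) (by omega), hsucc] at he
    by_contra hn
    exact (Finset.mem_filter.1 he).2.2 ⟨hd, hsW.symm ▸ hn⟩
  have hWdest : ∀ v ∈ W, v ≠ N.dest := by
    intro v hv
    rw [← hsW] at hv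
    have : v ∈ (N.trajectory G lam f₀ δ 0).nodes := nodes_antitone (Nat.zero_le t) hv
    simpa [trajectory, initState] using this
  have hout : ∀ v ∈ W, (N.activeOut s v).Nonempty := by
    intro v hv
    rw [← hW (t + 1) (by omega), hsucc] at hv
    exact Finset.nonempty_iff_ne_empty.2 (Finset.mem_filter.1 hv).2
  -- Grouping by tails turns the new flow into the inflows of the active nodes; grouping by heads in
  -- `h3` turns these inflows into the old flow.
  have h1 : ∑ e ∈ L, (N.trajectory G lam f₀ δ (t + 1)).flow e =
      ∑ v ∈ W, N.currentInflow lam s v := by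
    rw [← Finset.sum_fiberwise_of_maps_to htail]
    refine Finset.sum_congr rfl fun v hv => ?_
    rw [← G.sum_eq v (hWdest v hv) _ (activeOut_subset s v) (hout v hv) _
      (currentInflow_nonneg hlam (flow_nonneg hlam hf₀ t) v)]
    refine Finset.sum_congr (by ext e; simp [hsL, and_comm]) fun e he => ?_
    obtain ⟨rfl, he'⟩ := mem_activeOut.1 he
    exact flow_succ he'
  have h2 : ∑ v ∈ W, N.extInflow lam v = lam := by
    simp [extInflow, Finset.sum_ite_eq', ho]
  have h3 : ∑ v ∈ W, ∑ e ∈ N.inLinks v ∩ s.links, s.flow e =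
      ∑ e ∈ L with N.head e ≠ N.dest, s.flow e := by
    rw [← Finset.sum_fiberwise_of_maps_to (t := W) (g := N.head) fun e he =>
      hhead e (Finset.mem_filter.1 he).1 (Finset.mem_filter.1 he).2]
    refine Finset.sum_congr rfl fun v hv => Finset.sum_congr ?_ fun _ _ => rfl
    ext e
    simp only [Finset.mem_inter, mem_inLinks, Finset.mem_filter, hsL]
    constructor
    · rintro ⟨rfl, he⟩
      exact ⟨⟨he, hWdest _ hv⟩, rfl⟩
    · rintro ⟨⟨he, -⟩, h⟩
      exact ⟨h, he⟩
  have h4 : ∑ e ∈ N.inLinks N.dest, s.flow e = ∑ e ∈ L with ¬ N.head e ≠ N.dest, s.flow e := by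
    refine (Finset.sum_subset (fun e he => ?_) fun e he hne => ?_).symm
    · simpa using (Finset.mem_filter.1 he).2
    · have heL : e ∉ L := fun heL =>
        hne (Finset.mem_filter.2 ⟨heL, not_not.2 (mem_inLinks.1 he)⟩)
      -- The strict inequality `T₀ < t` is needed here: a link may still carry flow at the step at
      -- which it fails, but not one step later.
      obtain ⟨r, rfl⟩ : ∃ r, t = r + 1 := ⟨t - 1, by omega⟩
      exact flow_succ_eq_zero (by rwa [hL r (by omega)])
  have h5 := Finset.sum_filter_add_sum_filter_not L (fun e => N.head e ≠ N.dest) s.flow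
  have h6 : ∑ v ∈ W, N.currentInflow lam s v =
      ∑ v ∈ W, N.extInflow lam v + ∑ v ∈ W, ∑ e ∈ N.inLinks v ∩ s.links, s.flow e := by
    rw [← Finset.sum_add_distrib]; rfl
  linarith

/-- On a directed tree the dynamics is transferring as soon as the origin remains active. -/
theorem IsTree.isTransferring_of_origin_mem_nodes (h : N.IsTree) (hlam : 0 ≤ lam)
    (hf₀ : N.IsInitialFlow G lam f₀)
    (ho : ∀ t, N.origin ∈ (N.trajectory G lam f₀ δ t).nodes) :
    N.IsTransferring G lam f₀ δ := by
  obtain ⟨T₁, hT₁⟩ := exists_forall_eq_of_antitone (links_antitone (G := G) (lam := lam)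
    (f₀ := f₀) (δ := δ))
  obtain ⟨T₂, hT₂⟩ := exists_forall_eq_of_antitone (nodes_antitone (G := G) (lam := lam)
    (f₀ := f₀) (δ := δ))
  have hflow : ∀ e, ∃ c T, ∀ t ≥ T, (N.trajectory G lam f₀ δ t).flow e = c := fun e =>
    eventually_flow_eq_of_currentInflow hT₁ (h.eventually_currentInflow_eq hT₁ (tail_ne_dest e))
  choose c T hc using hflow
  have hev : ∀ t ≥ max (max T₁ T₂ + 1) (Finset.univ.sup T),
      ∑ e ∈ N.inLinks N.dest, (N.trajectory G lam f₀ δ t).flow e = lam := by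
    intro t ht
    have hTt : ∀ e, T e ≤ t := fun e =>
      (Finset.le_sup (Finset.mem_univ e)).trans ((le_max_right _ _).trans ht)
    have h1 := sum_flow_succ_add hlam hf₀ (t := t) (T₀ := max T₁ T₂)
      (fun s hs => hT₁ s ((le_max_left _ _).trans hs))
      (fun s hs => hT₂ s ((le_max_right _ _).trans hs)) (ho _)
      (Nat.lt_of_succ_le ((le_max_left _ _).trans ht))
    -- With constant flows the totals at `t` and `t + 1` cancel in the mass balance.
    rw [Finset.sum_congr rfl fun e _ => (hc e (t + 1) ((hTt e).trans (Nat.le_succ t))).trans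
      (hc e t (hTt e)).symm] at h1
    linarith
  exact tendsto_const_nhds.congr' ((eventually_ge_atTop _).mono fun t ht => (hev t ht).symm)

end Limit

end CascadingFailure.Network

theorem theorem2 {V E : Type*} [Fintype V] [Fintype E] [DecidableEq V] [DecidableEq E]
    (N : CascadingFailure.Network V E)
    (htree : N.IsTree)
    (hdeg : ∀ v, v ≠ N.dest → (N.outLinks v).card ≤ 3)
    (lam : ℝ) (hlam : 0 < lam)
    (G : N.RoutingPolicy) (hG : G.IsBPA htree.acyclic) (hmono : G.FlowMonotone)
    (f₀ : E → ℝ) (hf₀ : N.IsInitialFlow G lam f₀)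
    (δ : ℕ → E → ℝ) (hδ : N.IsDisturbance δ)
    (hsmall : CascadingFailure.magnitude δ <
      CascadingFailure.Network.upperMargin htree.acyclic lam) :
    N.IsTransferring G lam f₀ δ := by
  exact htree.isTransferring_of_origin_mem_nodes hlam.le hf₀
    (htree.origin_mem_nodes hdeg hlam.le hG hmono hf₀ hδ hsmall)
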